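/- Let $n\in\mathbb N$. For $\mathbf u=(u_1,\dots,u_{n+1})\in S^n\subset\mathbb R^{n+1}$ write $u=(u_1,\dots,u_n)\in\mathbb R^n$ and put $$H_{\mathbf u}^+=\{x\in\mathbb R^n\mid \langle u,x\rangle\ge u_{n+1}\},\qquad H_{\mathbf u}^-=\{x\in\mathbb R^n\mid \langle u,x\rangle\le u_{n+1}\}.$$ Let $A_1,\dots,A_n\subset\mathbb R^n$ be compact convex sets with non-empty interior, such that for every $i$, every boundary point $x$ of $A_i$ and every supporting hyperplane $H$ of $A_i$ at $x$, the set $A_i\cap H$ is a singleton. Let $Q_1,\dots,Q_n$ be non-singular real $n\times n$ matrices and set $f_i(x,\mathbf u)=\langle u,Q_ix\rangle$. Then there exists $\mathbf u\in S^n$ such that, for all $i=1,\dots,n$, both $A_i\cap H_{\mathbf u}^+$ and $A_i\cap H_{\mathbf u}^-$ are non-empty and $$\max_{x\in A_i\cap H_{\mathbf u}^+}f_i(x,\mathbf u)-\min_{x\in A_i\cap H_{\mathbf u}^+}f_i(x,\mathbf u)=\max_{x\in A_i\cap H_{\mathbf u}^-}f_i(x,\mathbf u)-\min_{x\in A_i\cap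 H_{\mathbf u}^-}f_i(x,\mathbf u).$$ -/

import Mathlib

namespace HamSandwichOpt

/-- The vector `u = (u₁, …, uₙ)` of the first `n` coordinates of `𝐮 = (u, uₙ₊₁)`. -/
def firstPart {n : ℕ} (u : EuclideanSpace ℝ (Fin (n + 1))) : EuclideanSpace ℝ (Fin n) :=
  WithLp.toLp 2 (fun j => u j.castSucc)

/-- The last coordinate `uₙ₊₁` of `𝐮 = (u, uₙ₊₁)`. -/
def lastPart {n : ℕ} (u : EuclideanSpace ℝ (Fin (n + 1))) : ℝ :=
  u (Fin.last n)

/-- The closed half-space `H⁺ = {x | ⟨u, x⟩ ≥ uₙ₊₁}` assigned to `𝐮`. -/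
def Hplus {n : ℕ} (u : EuclideanSpace ℝ (Fin (n + 1))) : Set (EuclideanSpace ℝ (Fin n)) :=
  {x | lastPart u ≤ inner ℝ (firstPart u) x}

/-- The closed half-space `H⁻ = {x | ⟨u, x⟩ ≤ uₙ₊₁}` assigned to `𝐮`. -/
def Hminus {n : ℕ} (u : EuclideanSpace ℝ (Fin (n + 1))) : Set (EuclideanSpace ℝ (Fin n)) :=
  {x | inner ℝ (firstPart u) x ≤ lastPart u}

/-- `H` is a supporting hyperplane of `A` at the point `x`: an affine hyperplane through
`x ∈ A` such that `A` lies in one of the two closed half-spaces it bounds. -/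
def IsSupportingHyperplaneAt {n : ℕ} (H A : Set (EuclideanSpace ℝ (Fin n)))
    (x : EuclideanSpace ℝ (Fin n)) : Prop :=
  x ∈ A ∧ ∃ c : EuclideanSpace ℝ (Fin n), c ≠ 0 ∧
    H = {y | inner ℝ c y = inner ℝ c x} ∧ ∀ y ∈ A, inner ℝ c y ≤ inner ℝ c x

/-- The objective function `f(x, 𝐮) = ⟨u, Q x⟩`. -/
noncomputable def bilinearObjective {n : ℕ} (Q : Matrix (Fin n) (Fin n) ℝ)
    (x : EuclideanSpace ℝ (Fin n)) (u : EuclideanSpace ℝ (Fin (n + 1))) : ℝ :=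
  inner ℝ (firstPart u) (WithLp.toLp 2 (Q.mulVec x))

/-- `d` is the max-min spread `max_{x ∈ S} g x - min_{x ∈ S} g x`, both extrema being attained. -/
def IsSpread {n : ℕ} (g : EuclideanSpace ℝ (Fin n) → ℝ) (S : Set (EuclideanSpace ℝ (Fin n)))
    (d : ℝ) : Prop :=
  ∃ M m : ℝ, IsGreatest (g '' S) M ∧ IsLeast (g '' S) m ∧ d = M - m

end HamSandwichOpt

/-! Apply Borsuk–Ulam to the map whose `i`-th coordinate is the spread of `f_i` on `A_i ∩ H⁺` minus
that on `A_i ∩ H⁻`; since `H⁻` at `u` is `H⁺` at `-u`, this map is odd. The singleton hypothesis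
makes it continuous: a half-space about to lose contact with `A_i` meets it in a single point, where
the spread is already `0`. The poles `u = (0, ±1)` are spurious zeros, so the odd correction
`poleBump` is subtracted; it keeps the map nonzero whenever the hyperplane misses a ball containing
all `A_i`. At a zero the spreads agree, and neither piece is empty, because non-singular `Q_i` gives
the whole of `A_i` positive spread.

Borsuk–Ulam is proved algebraically. Weierstrass approximation and homogenization of odd parts
reduce it to approximate zeros on the sphere of `n` forms of odd degree `d` in `n + 1` variables.
Setting one variable to `1` gives `f_1, …, f_n` of degree at most `d`. For generic `t` the ring
`ℝ[X] / (X_j ^ d + t f_j)` has dimension `d ^ n`, as at `t = 0`. This is odd, so the ring has a real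
character, that is, a real point with `f_j = -x_j ^ d / t`, which is small after normalization when
`t` is large. -/

namespace HamSandwichOpt

open MvPolynomial

/-! ### The monomial ideal generated by the powers `X_j ^ d`, and its syzygies. -/

section MonomialIdeal

variable {σ : Type*} {R : Type*} [CommRing R]

lemma mem_support_exists_of_sum_mul_X_pow {ι : Type*} (s : Finset ι) (x : ι → σ) (d : ℕ)
    (a : ι → MvPolynomial σ R) {e : σ →₀ ℕ}
    (he : e ∈ (∑ j ∈ s, a j * X (x j) ^ d).support) : ∃ j ∈ s, d ≤ e (x j) := by
  classical
  rw [mem_support_iff, coeff_sum] at he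
  obtain ⟨j, hj, hne⟩ := Finset.exists_ne_zero_of_sum_ne_zero he
  refine ⟨j, hj, ?_⟩
  rw [X_pow_eq_monomial, coeff_mul_monomial'] at hne
  by_contra hlt
  rw [if_neg] at hne
  · exact hne rfl
  · rwa [Finsupp.single_le_iff]

/-- Assign each monomial of `p` to one variable whose `d`-th power divides it, and divide; each
quotient has degree lower by `d`. -/
lemma exists_sum_mul_X_pow_of_support [Finite σ] {s : Finset σ} {d k : ℕ} {p : MvPolynomial σ R}
    (hp : p ∈ restrictTotalDegree σ R (k + d)) (h : ∀ e ∈ p.support, ∃ j ∈ s, d ≤ e j) :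
    ∃ b : σ → MvPolynomial σ R, (∀ j, b j ∈ restrictTotalDegree σ R k) ∧
      p = ∑ j ∈ s, b j * X j ^ d := by
  classical
  rcases eq_or_ne p 0 with rfl | hp0
  · exact ⟨0, fun _ => Submodule.zero_mem _, by simp⟩
  obtain ⟨e₀, he₀⟩ := support_nonempty.2 hp0
  have : Nonempty σ := ⟨(h e₀ he₀).choose⟩
  choose! j hj hd using h
  refine ⟨fun i => ∑ e ∈ p.support with j e = i,
    monomial (e - Finsupp.single i d) (coeff e p), fun i => ?_, ?_⟩
  · refine Submodule.sum_mem _ fun e he => ?_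
    rw [Finset.mem_filter] at he
    obtain ⟨he, rfl⟩ := he
    rw [mem_restrictTotalDegree] at hp ⊢
    refine (totalDegree_monomial_le _ _).trans ?_
    have h1 : e.sum (fun _ n => n) ≤ k + d := (le_totalDegree he).trans hp
    have h2 : e = (e - Finsupp.single (j e) d) + Finsupp.single (j e) d :=
      (tsub_add_cancel_of_le (Finsupp.single_le_iff.2 (hd e he))).symm
    rw [h2, Finsupp.sum_add_index' (fun _ => rfl) (fun _ _ _ => rfl),
      Finsupp.sum_single_index rfl] at h1
    exact Nat.add_le_add_iff_right.1 h1
  · conv_lhs => rw [p.as_sum]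
    rw [← Finset.sum_fiberwise_of_maps_to (t := s) (g := j) hj]
    refine Finset.sum_congr rfl fun i _ => ?_
    rw [Finset.sum_mul]
    refine Finset.sum_congr rfl fun e he => ?_
    rw [Finset.mem_filter] at he
    obtain ⟨he, rfl⟩ := he
    rw [X_pow_eq_monomial, monomial_mul, mul_one,
      tsub_add_cancel_of_le (Finsupp.single_le_iff.2 (hd e he))]

/-- Syzygies of powers of the variables are Koszul syzygies, with control of the degree. -/
lemma exists_koszul_of_sum_mul_X_pow_eq_zero [Finite σ] [DecidableEq σ] (d k : ℕ) (s : Finset σ)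
    (a : σ → MvPolynomial σ R) (ha : ∀ j, a j ∈ restrictTotalDegree σ R (k + d))
    (h : ∑ j ∈ s, a j * X j ^ d = 0) :
    ∃ c : σ → σ → MvPolynomial σ R, (∀ i j, c i j ∈ restrictTotalDegree σ R k) ∧
      ∀ i ∈ s, a i = ∑ j ∈ s, (c i j - c j i) * X j ^ d := by
  induction s using Finset.induction_on generalizing a with
  | empty => exact ⟨0, fun _ _ => Submodule.zero_mem _, by simp⟩
  | insert i s hi ih =>
    rw [Finset.sum_insert hi] at h
    -- `a i * X i ^ d` lies in the monomial ideal of the other powers, and `X i ^ d` contributes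
    -- nothing to the exponents of those variables, so `a i` lies in that ideal too.
    have hsupp : ∀ e ∈ (a i).support, ∃ j ∈ s, d ≤ e j := by
      intro e he
      have h1 : e + Finsupp.single i d ∈ (∑ j ∈ s, (-a j) * X j ^ d).support := by
        have h2 : ∑ j ∈ s, (-a j) * X j ^ d = a i * X i ^ d := by
          rw [eq_neg_of_add_eq_zero_left h, ← Finset.sum_neg_distrib]
          simp
        rw [h2, mem_support_iff, X_pow_eq_monomial, coeff_mul_monomial, mul_one]
        exact mem_support_iff.1 he
      obtain ⟨j, hj, hd⟩ := mem_support_exists_of_sum_mul_X_pow s id d _ h1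
      refine ⟨j, hj, ?_⟩
      have : i ≠ j := fun hij => hi (hij ▸ hj)
      simpa [Finsupp.single_apply, this] using hd
    obtain ⟨b, hb, hab⟩ := exists_sum_mul_X_pow_of_support (ha i) hsupp
    -- Substituting `a i = ∑ b j * X j ^ d` into the relation turns it into a syzygy over `s` alone.
    obtain ⟨c, hc, hac⟩ := ih (fun j => a j + b j * X i ^ d)
      (fun j => Submodule.add_mem _ (ha j) (by
        have := hb j
        rw [mem_restrictTotalDegree] at this ⊢
        refine (totalDegree_mul _ _).trans (add_le_add this ?_)
        rw [X_pow_eq_monomial]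
        refine (totalDegree_monomial_le _ _).trans ?_
        simp))
      (by
        simp only [add_mul, Finset.sum_add_distrib]
        rw [← h, hab, Finset.sum_mul, add_comm]
        congr 1
        exact Finset.sum_congr rfl fun j _ => by ring)
    refine ⟨fun l m => if l = i then b m else if m = i then 0 else c l m, fun l m => ?_, ?_⟩
    · dsimp only
      split_ifs
      exacts [hb m, Submodule.zero_mem _, hc l m]
    · intro l hl
      rw [Finset.sum_insert hi]
      have hne : ∀ m ∈ s, m ≠ i := fun m hm hmi => hi (hmi ▸ hm)
      rcases Finset.mem_insert.1 hl with rfl | hl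
      · simp only [if_true, sub_self, zero_mul, zero_add]
        rw [hab]
        exact Finset.sum_congr rfl fun m hm => by simp [hne m hm]
      · have h1 := hac l hl
        rw [eq_comm, ← sub_eq_iff_eq_add] at h1
        rw [← h1, sub_eq_neg_add]
        congr 1
        · simp [hne l hl]
        · exact Finset.sum_congr rfl fun m hm => by simp [hne m hm, hne l hl]

instance restrictTotalDegree_finite [Finite σ] (m : ℕ) :
    Module.Finite R (restrictTotalDegree σ R m) := by
  have : Set.Finite {n : σ →₀ ℕ | (n.sum fun _ e => e) ≤ m} := by
    classical
    have := Fintype.ofFinite σ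
    refine ((Set.finite_Icc 0 fun _ : σ => m).preimage
      (f := fun n : σ →₀ ℕ => (n : σ → ℕ)) DFunLike.coe_injective.injOn).subset
      fun n hn => ⟨fun _ => Nat.zero_le _, fun i => ?_⟩
    simp only [Set.mem_ofPred_eq] at hn
    rw [Finsupp.sum_fintype _ _ (fun _ => rfl)] at hn
    exact (Finset.single_le_sum (f := fun i => n i) (fun _ _ => Nat.zero_le _)
      (Finset.mem_univ i)).trans hn
  have := this.to_subtype
  exact Module.Finite.of_basis (basisRestrictSupport R {n : σ →₀ ℕ | (n.sum fun _ e => e) ≤ m})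

end MonomialIdeal

/-! ### Linear maps depending affinely on a parameter. -/

section Generic

variable {E F : Type*} [AddCommGroup E] [Module ℝ E] [FiniteDimensional ℝ E]
  [AddCommGroup F] [Module ℝ F]

/-- With `L` a left inverse of `T₀`, a kernel vector of `T₀ + t T₁` is killed by `1 + t L T₁`, so
`-t⁻¹` is one of the finitely many eigenvalues of `L T₁`. -/
lemma finite_setOf_not_injective_add_smul (T₀ T₁ : E →ₗ[ℝ] F) (h : Function.Injective T₀) :
    {t : ℝ | ¬ Function.Injective (T₀ + t • T₁)}.Finite := by
  obtain ⟨L, hL⟩ := T₀.exists_leftInverse_of_injective (LinearMap.ker_eq_bot.2 h)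
  have hfin := Module.End.finite_hasEigenvalue (L ∘ₗ T₁)
  refine (hfin.preimage (f := fun t : ℝ => -t⁻¹)
    (fun x _ y _ hxy => by simpa using hxy)).subset fun t ht => ?_
  simp only [Set.mem_ofPred_eq, Set.mem_preimage] at ht ⊢
  rw [← LinearMap.ker_eq_bot, LinearMap.ker_eq_bot', not_forall] at ht
  obtain ⟨v, hv⟩ := ht
  rw [Classical.not_imp] at hv
  obtain ⟨hv, hv0⟩ := hv
  have h1 : v + t • L (T₁ v) = 0 := by
    have := congrArg L hv
    have h2 : L (T₀ v) = v := LinearMap.congr_fun hL v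
    simpa [h2] using this
  have ht0 : t ≠ 0 := by
    rintro rfl
    exact hv0 (by simpa using h1)
  refine Module.End.hasEigenvalue_of_hasEigenvector (x := v) ⟨?_, hv0⟩
  rw [Module.End.mem_eigenspace_iff, LinearMap.comp_apply, neg_smul, ← smul_neg,
    ← eq_neg_of_add_eq_zero_right h1, smul_smul, inv_mul_cancel₀ ht0, one_smul]

end Generic

lemma exists_linear_section {K E F : Type*} [Field K] [AddCommGroup E] [Module K E]
    [AddCommGroup F] [Module K F] (f : E →ₗ[K] F) (N : Submodule K F)
    (h : N ≤ LinearMap.range f) : ∃ τ : N →ₗ[K] E, f ∘ₗ τ = N.subtype := by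
  obtain ⟨s, hs⟩ := f.rangeRestrict.exists_rightInverse_of_surjective f.range_rangeRestrict
  refine ⟨s ∘ₗ Submodule.inclusion h, LinearMap.ext fun x => ?_⟩
  have := LinearMap.congr_fun hs (Submodule.inclusion h x)
  exact congrArg Subtype.val this

end HamSandwichOpt

namespace HamSandwichOpt

open MvPolynomial

/-! ### Deforming the ideal `(X_j ^ d)` with constant quotient dimension. -/

section Deformation

variable {σ : Type*} [Fintype σ]

/-- The map `(a_j) ↦ ∑ a_j g_j` on tuples of polynomials of total degree at most `k`. -/
noncomputable def combination (g : σ → MvPolynomial σ ℝ) (k : ℕ) :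
    (σ → restrictTotalDegree σ ℝ k) →ₗ[ℝ] MvPolynomial σ ℝ :=
  ∑ j, LinearMap.mulRight ℝ (g j) ∘ₗ (restrictTotalDegree σ ℝ k).subtype ∘ₗ LinearMap.proj j

lemma combination_apply (g : σ → MvPolynomial σ ℝ) (k : ℕ) (a : σ → restrictTotalDegree σ ℝ k) :
    combination g k a = ∑ j, (a j : MvPolynomial σ ℝ) * g j := by
  simp [combination]

/-- The map sending a matrix of polynomials `c` to the Koszul syzygy `∑ (c_ij - c_ji) g_j`. -/
noncomputable def koszul (g : σ → MvPolynomial σ ℝ) (k : ℕ) :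
    (σ → σ → restrictTotalDegree σ ℝ k) →ₗ[ℝ] (σ → MvPolynomial σ ℝ) :=
  LinearMap.pi fun i => ∑ j, LinearMap.mulRight ℝ (g j) ∘ₗ
    (restrictTotalDegree σ ℝ k).subtype ∘ₗ
      ((LinearMap.proj j : (σ → restrictTotalDegree σ ℝ k) →ₗ[ℝ] _) ∘ₗ LinearMap.proj i -
        (LinearMap.proj i : (σ → restrictTotalDegree σ ℝ k) →ₗ[ℝ] _) ∘ₗ LinearMap.proj j)

lemma koszul_apply (g : σ → MvPolynomial σ ℝ) (k : ℕ)
    (c : σ → σ → restrictTotalDegree σ ℝ k) (i : σ) :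
    koszul g k c i = ∑ j, ((c i j : MvPolynomial σ ℝ) - c j i) * g j := by
  simp [koszul]

lemma sum_koszul_mul (g : σ → MvPolynomial σ ℝ) (k : ℕ)
    (c : σ → σ → restrictTotalDegree σ ℝ k) : ∑ i, koszul g k c i * g i = 0 := by
  simp only [koszul_apply, Finset.sum_mul, sub_mul, Finset.sum_sub_distrib]
  rw [sub_eq_zero, Finset.sum_comm]
  exact Finset.sum_congr rfl fun i _ => Finset.sum_congr rfl fun j _ => by ring

/-- The polynomial with the given coefficients at monomials whose exponents are all below `d`. -/
noncomputable def ofBoxCoeffs (σ : Type*) [Fintype σ] [DecidableEq σ] (d : ℕ) :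
    ((σ → Fin d) → ℝ) →ₗ[ℝ] MvPolynomial σ ℝ :=
  ∑ e : σ → Fin d, monomial (Finsupp.equivFunOnFinite.symm fun i => (e i : ℕ)) ∘ₗ
    LinearMap.proj e

/-- The coefficients at monomials whose exponents are all below `d`. -/
noncomputable def boxCoeffs (σ : Type*) [Finite σ] (d : ℕ) :
    MvPolynomial σ ℝ →ₗ[ℝ] ((σ → Fin d) → ℝ) :=
  LinearMap.pi fun e => lcoeff ℝ (Finsupp.equivFunOnFinite.symm fun i => (e i : ℕ))

lemma boxCoeffs_combination (d k : ℕ) (a : σ → restrictTotalDegree σ ℝ k) :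
    boxCoeffs σ d (combination (fun j => X j ^ d) k a) = 0 := by
  ext e
  simp only [boxCoeffs, LinearMap.pi_apply, lcoeff_apply, Pi.zero_apply]
  by_contra hne
  rw [← ne_eq, ← mem_support_iff, combination_apply] at hne
  obtain ⟨j, -, hj⟩ := mem_support_exists_of_sum_mul_X_pow _ id d _ hne
  have := (e j).2
  simp only [id, Finsupp.equivFunOnFinite_symm_apply_apply] at hj
  omega

lemma combination_mem {d k : ℕ} {g : σ → MvPolynomial σ ℝ} (hg : ∀ j, (g j).totalDegree ≤ d)
    (a : σ → restrictTotalDegree σ ℝ k) :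
    combination g k a ∈ restrictTotalDegree σ ℝ (k + d) := by
  rw [combination_apply]
  refine Submodule.sum_mem _ fun j _ => ?_
  rw [mem_restrictTotalDegree]
  exact (totalDegree_mul _ _).trans
    (add_le_add ((mem_restrictTotalDegree _ _ _).1 (a j).2) (hg j))

lemma koszul_mem {d k : ℕ} {g : σ → MvPolynomial σ ℝ} (hg : ∀ j, (g j).totalDegree ≤ d)
    (c : σ → σ → restrictTotalDegree σ ℝ k) (i : σ) :
    koszul g k c i ∈ restrictTotalDegree σ ℝ (k + d) := by
  rw [koszul_apply]
  refine Submodule.sum_mem _ fun j _ => ?_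
  rw [mem_restrictTotalDegree]
  exact (totalDegree_mul _ _).trans
    (add_le_add ((mem_restrictTotalDegree _ _ _).1 (c i j - c j i).2) (hg j))

/-- The ideal generators `X_j ^ d + t f_j`. -/
noncomputable def deformedPower {σ : Type*} (f : σ → MvPolynomial σ ℝ) (d : ℕ) (t : ℝ) (j : σ) :
    MvPolynomial σ ℝ :=
  X j ^ d + t • f j

lemma totalDegree_deformedPower_le {σ : Type*} {f : σ → MvPolynomial σ ℝ} {d : ℕ}
    (hf : ∀ j, (f j).totalDegree ≤ d) (t : ℝ) (j : σ) :
    (deformedPower f d t j).totalDegree ≤ d :=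
  (totalDegree_add _ _).trans
    (max_le (totalDegree_X_pow j d).le ((totalDegree_smul_le _ _).trans (hf j)))

lemma exists_combination_of_boxCoeffs_eq_zero {d k : ℕ} {p : MvPolynomial σ ℝ}
    (hp : p ∈ restrictTotalDegree σ ℝ (k + d)) (h : boxCoeffs σ d p = 0) :
    ∃ a, combination (fun j => X j ^ d) k a = p := by
  obtain ⟨b, hb, hpb⟩ := exists_sum_mul_X_pow_of_support (s := Finset.univ) hp (by
    intro e he
    by_contra! hlt
    have := congrFun h fun i => ⟨e i, hlt i (Finset.mem_univ i)⟩
    simp only [boxCoeffs, LinearMap.pi_apply, lcoeff_apply, Pi.zero_apply] at this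
    refine mem_support_iff.1 he ?_
    rwa [show e = Finsupp.equivFunOnFinite.symm fun i => e i from Finsupp.ext fun i => by simp])
  exact ⟨fun j => ⟨b j, hb j⟩, by rw [combination_apply, hpb]⟩

variable [DecidableEq σ]

lemma boxCoeffs_ofBoxCoeffs (d : ℕ) (c : (σ → Fin d) → ℝ) :
    boxCoeffs σ d (ofBoxCoeffs σ d c) = c := by
  ext e
  simp only [boxCoeffs, ofBoxCoeffs, LinearMap.pi_apply, LinearMap.sum_apply,
    LinearMap.comp_apply, LinearMap.proj_apply, lcoeff_apply, coeff_sum, coeff_monomial]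
  rw [Finset.sum_eq_single e]
  · simp
  · intro e' _ hne
    rw [if_neg]
    intro h
    refine hne (funext fun i => Fin.ext ?_)
    have := DFunLike.congr_fun h i
    simpa using this
  · simp

lemma ofBoxCoeffs_mem (d : ℕ) {m : ℕ} (hm : Fintype.card σ * d ≤ m) (c : (σ → Fin d) → ℝ) :
    ofBoxCoeffs σ d c ∈ restrictTotalDegree σ ℝ m := by
  simp only [ofBoxCoeffs, LinearMap.sum_apply, LinearMap.comp_apply, LinearMap.proj_apply]
  refine Submodule.sum_mem _ fun e _ => ?_
  rw [mem_restrictTotalDegree]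
  refine (totalDegree_monomial_le _ _).trans (le_trans ?_ hm)
  rw [Finsupp.sum_fintype _ _ (fun _ => rfl)]
  refine (Finset.sum_le_card_nsmul _ _ d fun i _ => ?_).trans_eq (by simp)
  simp

/-- The map `(c, a) ↦ c + ∑ a_j g_j`, with `c` spanned by the monomials below `X_j ^ d`. -/
noncomputable def boxCombination (g : σ → MvPolynomial σ ℝ) (d k : ℕ) :
    ((σ → Fin d) → ℝ) × (σ → restrictTotalDegree σ ℝ k) →ₗ[ℝ] MvPolynomial σ ℝ :=
  (ofBoxCoeffs σ d).coprod (combination g k)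

lemma range_boxCombination_le {d k : ℕ} {g : σ → MvPolynomial σ ℝ}
    (hg : ∀ j, (g j).totalDegree ≤ d) (hk : Fintype.card σ * d ≤ k) :
    LinearMap.range (boxCombination g d k) ≤ restrictTotalDegree σ ℝ (k + d) := by
  rintro _ ⟨⟨c, a⟩, rfl⟩
  exact Submodule.add_mem _ (ofBoxCoeffs_mem d (by omega) c) (combination_mem hg a)

lemma range_boxCombination_X_pow {d k : ℕ} (hk : Fintype.card σ * d ≤ k) :
    LinearMap.range (boxCombination (fun j : σ => X j ^ d) d k) =
      restrictTotalDegree σ ℝ (k + d) := by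
  refine le_antisymm (range_boxCombination_le (fun j => (totalDegree_X_pow j d).le) hk)
    fun p hp => ?_
  obtain ⟨a, ha⟩ := exists_combination_of_boxCoeffs_eq_zero (d := d) (k := k)
    (p := p - ofBoxCoeffs σ d (boxCoeffs σ d p))
    (Submodule.sub_mem _ hp (ofBoxCoeffs_mem d (by omega) _))
    (by rw [map_sub, boxCoeffs_ofBoxCoeffs, sub_self])
  exact ⟨(boxCoeffs σ d p, a), by simp [boxCombination, ha]⟩

variable {f : σ → MvPolynomial σ ℝ} {d : ℕ}

/-- A linear section `τ` at `t = 0`, kept fixed, makes the composite affine in `t` and equal to the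
inclusion at `t = 0`. It stays injective for all but finitely many `t`, and then its image fills the
target by dimension. -/
lemma finite_range_boxCombination_ne (hf : ∀ j, (f j).totalDegree ≤ d) {k : ℕ}
    (hk : Fintype.card σ * d ≤ k) :
    {t : ℝ | LinearMap.range (boxCombination (deformedPower f d t) d k) ≠
      restrictTotalDegree σ ℝ (k + d)}.Finite := by
  obtain ⟨τ, hτ⟩ := exists_linear_section _ _ (range_boxCombination_X_pow (σ := σ) hk).ge
  refine (finite_setOf_not_injective_add_smul (restrictTotalDegree σ ℝ (k + d)).subtype
    (combination f k ∘ₗ LinearMap.snd ℝ _ _ ∘ₗ τ) Subtype.val_injective).subset fun t ht hinj => ht ?_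
  have key : (restrictTotalDegree σ ℝ (k + d)).subtype +
      t • (combination f k ∘ₗ LinearMap.snd ℝ _ _ ∘ₗ τ) =
      boxCombination (deformedPower f d t) d k ∘ₗ τ := by
    rw [← hτ]
    ext1 p
    simp [boxCombination, combination_apply, deformedPower, mul_add, Finset.sum_add_distrib,
      Finset.smul_sum, add_assoc]
  rw [key] at hinj
  have h1 := range_boxCombination_le (totalDegree_deformedPower_le hf t) hk
  have h2 : LinearMap.range (boxCombination (deformedPower f d t) d k ∘ₗ τ) ≤
    LinearMap.range (boxCombination (deformedPower f d t) d k) := LinearMap.range_comp_le_range _ _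
  have h3 := Submodule.eq_of_le_of_finrank_eq (h2.trans h1) (LinearMap.finrank_range_of_inj hinj)
  exact le_antisymm h1 (h3 ▸ h2)

/-- Kernels normally shrink under perturbation. Here the syzygies at `t = 0` are all Koszul, and a
Koszul syzygy deforms by using the same `c` with the deformed generators; independence survives for
all but finitely many `t`. -/
lemma finite_finrank_ker_combination_lt (hf : ∀ j, (f j).totalDegree ≤ d) (k : ℕ) :
    {t : ℝ | Module.finrank ℝ (LinearMap.ker (combination (deformedPower f d t) (k + d))) <
      Module.finrank ℝ (LinearMap.ker (combination (fun j : σ => X j ^ d) (k + d)))}.Finite := by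
  set N := LinearMap.ker (combination (fun j : σ => X j ^ d) (k + d)) with hN
  let ι : (σ → restrictTotalDegree σ ℝ (k + d)) →ₗ[ℝ] (σ → MvPolynomial σ ℝ) :=
    LinearMap.pi fun j => (restrictTotalDegree σ ℝ (k + d)).subtype ∘ₗ LinearMap.proj j
  have hι : Function.Injective ι := fun a b hab =>
    funext fun j => Subtype.ext (congrFun hab j)
  obtain ⟨τ, hτ⟩ := exists_linear_section (koszul (fun j : σ => X j ^ d) k) (N.map ι) (by
    rintro _ ⟨a, ha, rfl⟩
    rw [SetLike.mem_coe, hN, LinearMap.mem_ker, combination_apply] at ha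
    obtain ⟨c, hc, hac⟩ := exists_koszul_of_sum_mul_X_pow_eq_zero d k Finset.univ
      (fun j => (a j : MvPolynomial σ ℝ)) (fun j => (a j).2) ha
    refine ⟨fun i j => ⟨c i j, hc i j⟩, funext fun i => ?_⟩
    rw [koszul_apply]
    exact (hac i (Finset.mem_univ i)).symm)
  refine (finite_setOf_not_injective_add_smul (N.map ι).subtype (koszul f k ∘ₗ τ)
    Subtype.val_injective).subset fun t ht hinj => ?_
  rw [Set.mem_ofPred_eq] at ht
  refine ht.not_ge ?_
  have key : (N.map ι).subtype + t • (koszul f k ∘ₗ τ) = koszul (deformedPower f d t) k ∘ₗ τ := by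
    rw [← hτ]
    refine LinearMap.ext fun p => funext fun i => ?_
    simp [koszul_apply, deformedPower, mul_add, Finset.sum_add_distrib, Finset.smul_sum]
  rw [key] at hinj
  have hle : LinearMap.range (koszul (deformedPower f d t) k ∘ₗ τ) ≤
      (LinearMap.ker (combination (deformedPower f d t) (k + d))).map ι := by
    rintro _ ⟨p, rfl⟩
    refine ⟨fun j => ⟨_, koszul_mem (totalDegree_deformedPower_le hf t) (τ p) j⟩, ?_, rfl⟩
    rw [SetLike.mem_coe, LinearMap.mem_ker, combination_apply]
    exact sum_koszul_mul _ _ _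
  have h1 := Submodule.finrank_mono hle
  rwa [LinearMap.finrank_range_of_inj hinj, (Submodule.equivMapOfInjective ι hι _).symm.finrank_eq,
    (Submodule.equivMapOfInjective ι hι _).symm.finrank_eq] at h1

lemma ker_boxCombination_X_pow {k : ℕ} :
    LinearMap.ker (boxCombination (fun j : σ => X j ^ d) d k) =
      (LinearMap.ker (combination (fun j : σ => X j ^ d) k)).map (LinearMap.inr ℝ _ _) := by
  ext ⟨c, a⟩
  simp only [boxCombination, LinearMap.mem_ker, LinearMap.coprod_apply, Submodule.mem_map,
    LinearMap.inr_apply, Prod.mk.injEq]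
  constructor
  · intro h
    have hc : c = 0 := by
      have := congrArg (boxCoeffs σ d) h
      rwa [map_add, boxCoeffs_ofBoxCoeffs, boxCoeffs_combination, add_zero, map_zero] at this
    subst hc
    exact ⟨a, by simpa using h, rfl, rfl⟩
  · rintro ⟨a, ha, rfl, rfl⟩
    simpa using ha

/-- Equal ranges give kernels of equal dimension at `t` and at `0`. The syzygies already account for
that dimension, so no nonzero box polynomial is a combination of the generators with coefficients in
this degree range. -/
lemma ker_boxCombination_of_generic {k : ℕ} (hk : Fintype.card σ * d ≤ k) {t : ℝ}
    (h1 : LinearMap.range (boxCombination (deformedPower f d t) d k) =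
      restrictTotalDegree σ ℝ (k + d))
    (h2 : Module.finrank ℝ (LinearMap.ker (combination (fun j : σ => X j ^ d) k)) ≤
      Module.finrank ℝ (LinearMap.ker (combination (deformedPower f d t) k))) :
    LinearMap.ker (boxCombination (deformedPower f d t) d k) =
      (LinearMap.ker (combination (deformedPower f d t) k)).map (LinearMap.inr ℝ _ _) := by
  have r1 := LinearMap.finrank_range_add_finrank_ker (boxCombination (deformedPower f d t) d k)
  have r2 := LinearMap.finrank_range_add_finrank_ker (boxCombination (fun j : σ => X j ^ d) d k)
  rw [range_boxCombination_X_pow hk, ← h1, ← r1, add_right_inj, ker_boxCombination_X_pow,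
    (Submodule.equivMapOfInjective _ LinearMap.inr_injective _).symm.finrank_eq] at r2
  refine (Submodule.eq_of_le_of_finrank_le ?_ ?_).symm
  · rintro _ ⟨a, ha, rfl⟩
    simpa [boxCombination] using ha
  · rw [(Submodule.equivMapOfInjective _ LinearMap.inr_injective _).symm.finrank_eq, ← r2]
    exact h2

/-- Off a countable set of parameters, `X_j ^ d + t f_j` has a quotient ring of dimension
`d ^ n`. -/
lemma countable_finrank_quotient_ne (hf : ∀ j, (f j).totalDegree ≤ d) :
    ∃ S : Set ℝ, S.Countable ∧ ∀ t ∉ S,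
      Module.finrank ℝ (MvPolynomial σ ℝ ⧸ Ideal.span (Set.range (deformedPower f d t))) =
        d ^ Fintype.card σ := by
  set n := Fintype.card σ
  -- The summand `n * d` makes room for every box monomial, and the further `d` for Koszul
  -- coefficients of degree `d` lower. All `k` are needed since membership in the ideal bounds no
  -- degree.
  refine ⟨(⋃ k : ℕ, {t : ℝ | LinearMap.range (boxCombination (deformedPower f d t) d
      (k + n * d + d)) ≠ restrictTotalDegree σ ℝ (k + n * d + d + d)}) ∪
    ⋃ k : ℕ, {t : ℝ | Module.finrank ℝ (LinearMap.ker (combination (deformedPower f d t)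
      (k + n * d + d))) < Module.finrank ℝ (LinearMap.ker (combination (fun j : σ => X j ^ d)
      (k + n * d + d)))},
    (Set.countable_iUnion fun k =>
      (finite_range_boxCombination_ne hf (by simp only [n]; omega)).countable).union
    (Set.countable_iUnion fun k => (finite_finrank_ker_combination_lt hf _).countable),
    fun t ht => ?_⟩
  simp only [Set.mem_union, Set.mem_iUnion, Set.mem_ofPred_eq, not_or, not_exists, not_not,
    not_lt] at ht
  obtain ⟨hr, hk⟩ := ht
  set I := Ideal.span (Set.range (deformedPower f d t))
  have hmem : ∀ k a, combination (deformedPower f d t) k a ∈ I := fun k a => by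
    rw [combination_apply]
    exact Ideal.sum_mem _ fun j _ => Ideal.mul_mem_left _ _ (Ideal.subset_span ⟨j, rfl⟩)
  let q : ((σ → Fin d) → ℝ) →ₗ[ℝ] MvPolynomial σ ℝ ⧸ I :=
    (Ideal.Quotient.mkₐ ℝ I).toLinearMap ∘ₗ ofBoxCoeffs σ d
  have hq : Function.Bijective q := by
    constructor
    · rw [← LinearMap.ker_eq_bot, LinearMap.ker_eq_bot']
      intro c hc
      have hc' : ofBoxCoeffs σ d c ∈ I := Ideal.Quotient.eq_zero_iff_mem.1 hc
      obtain ⟨a, ha⟩ := Ideal.mem_span_range_iff_exists_fun.1 hc'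
      set k := Finset.univ.sup fun j => (a j).totalDegree
      have hka : ∀ j, -a j ∈ restrictTotalDegree σ ℝ (k + n * d + d) := fun j =>
        Submodule.neg_mem _ ((mem_restrictTotalDegree _ _ _).2 (by
          have : (a j).totalDegree ≤ k :=
            Finset.le_sup (f := fun j => (a j).totalDegree) (Finset.mem_univ j)
          omega))
      have h1 : (c, fun j => ⟨-a j, hka j⟩) ∈
          LinearMap.ker (boxCombination (deformedPower f d t) d (k + n * d + d)) := by
        simp [boxCombination, combination_apply, ha]
      rw [ker_boxCombination_of_generic (by simp only [n]; omega) (hr k) (hk k)] at h1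
      obtain ⟨a', -, h2⟩ := h1
      exact (congrArg Prod.fst h2).symm
    · intro y
      obtain ⟨p, rfl⟩ := Ideal.Quotient.mk_surjective y
      have hp : p ∈ restrictTotalDegree σ ℝ (p.totalDegree + n * d + d + d) :=
        (mem_restrictTotalDegree _ _ _).2 (by omega)
      rw [← hr] at hp
      obtain ⟨⟨c, a⟩, hca⟩ := hp
      refine ⟨c, ?_⟩
      rw [← hca]
      simp only [q, boxCombination, LinearMap.coprod_apply, LinearMap.comp_apply, map_add]
      rw [Ideal.Quotient.eq_zero_iff_mem.2 (hmem _ a), add_zero]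
      rfl
  rw [← (LinearEquiv.ofBijective q hq).finrank_eq, Module.finrank_fintype_fun_eq_card]
  simp [n]

end Deformation

end HamSandwichOpt

/-! ### Real points from odd dimension. -/

namespace HamSandwichOpt

open MvPolynomial

lemma exists_isRoot_of_monic_of_odd_natDegree {p : Polynomial ℝ} (hp : p.Monic)
    (hodd : Odd p.natDegree) : ∃ x, p.IsRoot x := by
  have hdeg : 0 < p.natDegree := hodd.pos
  have h1 := p.tendsto_atTop_of_leadingCoeff_nonneg (Polynomial.natDegree_pos_iff_degree_pos.1 hdeg)
    (by simp [hp.leadingCoeff])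
  have hneg : (-Polynomial.X : Polynomial ℝ).natDegree = 1 := by simp
  have h2 := (p.comp (-Polynomial.X)).tendsto_atBot_of_leadingCoeff_nonpos
    (Polynomial.natDegree_pos_iff_degree_pos.1 (by rwa [Polynomial.natDegree_comp, hneg, mul_one]))
    (by rw [Polynomial.leadingCoeff_comp (by simp [hneg])]; simp [hp.leadingCoeff, hodd.neg_one_pow])
  obtain ⟨a, ha⟩ := (h1.eventually_ge_atTop 0).exists
  obtain ⟨b, hb⟩ := (h2.eventually_le_atBot 0).exists
  rw [Polynomial.eval_comp] at hb
  exact mem_range_of_exists_le_of_exists_ge p.continuous ⟨_, hb⟩ ⟨a, ha⟩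

lemma exists_hasEigenvalue_of_odd_finrank {V : Type*} [AddCommGroup V] [Module ℝ V]
    (hV : Odd (Module.finrank ℝ V)) (f : Module.End ℝ V) : ∃ μ, f.HasEigenvalue μ := by
  have := Module.finite_of_finrank_pos hV.pos
  obtain ⟨μ, hμ⟩ := exists_isRoot_of_monic_of_odd_natDegree f.charpoly_monic
    (by rwa [f.charpoly_natDegree])
  exact ⟨μ, (Module.End.hasEigenvalue_iff_isRoot_charpoly f μ).2 hμ⟩

/-- A commutative real algebra acting on an odd-dimensional space has a real character. -/
lemma nonempty_algHom_of_odd_finrank_module {B : Type*} [CommRing B] [Algebra ℝ B] (n : ℕ)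
    (M : Type*) [AddCommGroup M] [Module ℝ M] [Module B M] [IsScalarTower ℝ B M]
    (hM : Module.finrank ℝ M = n) (hodd : Odd n) : Nonempty (B →ₐ[ℝ] ℝ) := by
  induction n using Nat.strong_induction_on generalizing M with
  | _ n ih =>
  have hfin : Module.Finite ℝ M := Module.finite_of_finrank_pos (hM ▸ hodd.pos)
  have hnt : Nontrivial M := Module.nontrivial_of_finrank_pos (R := ℝ) (hM ▸ hodd.pos)
  by_cases hscal : ∀ b : B, ∃ r : ℝ, ∀ m : M, b • m = r • m
  · choose χ hχ using hscal
    obtain ⟨v, hv⟩ := exists_ne (0 : M)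
    have hinj : ∀ {r s : ℝ}, r • v = s • v → r = s := fun h => smul_left_injective ℝ hv h
    exact ⟨{
      toFun := χ
      map_one' := hinj (by rw [← hχ, one_smul, one_smul])
      map_mul' := fun a b => hinj (by rw [← hχ, mul_smul, hχ b, hχ a, mul_smul])
      map_zero' := hinj (by rw [← hχ, zero_smul, zero_smul])
      map_add' := fun a b => hinj (by rw [← hχ, add_smul, hχ b, hχ a, add_smul])
      commutes' := fun r => hinj (by rw [← hχ, algebraMap_smul]; rfl) }⟩
  · push Not at hscal
    obtain ⟨b, hb⟩ := hscal
    obtain ⟨r, hr⟩ := exists_hasEigenvalue_of_odd_finrank (hM ▸ hodd) (Algebra.lsmul ℝ ℝ M b)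
    obtain ⟨v, hv⟩ := hr.exists_hasEigenvector
    -- By commutativity the kernel and range of `b - r` are `B`-submodules. Both are nonzero and
    -- their dimensions add up to `n`, so one of them is odd-dimensional and smaller than `M`.
    let f : M →ₗ[B] M := LinearMap.lsmul B M (b - algebraMap ℝ B r)
    have hf : ∀ m, f m = b • m - r • m := fun m => by
      simp only [f, LinearMap.lsmul_apply, sub_smul, algebraMap_smul]
    have hsum := LinearMap.finrank_range_add_finrank_ker (f.restrictScalars ℝ)
    rw [hM] at hsum
    change Module.finrank ℝ (LinearMap.range f) + Module.finrank ℝ (LinearMap.ker f) = n at hsum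
    have hpos : 0 < Module.finrank ℝ (LinearMap.ker f) := by
      have : v ∈ LinearMap.ker f := by
        rw [LinearMap.mem_ker, hf, sub_eq_zero]
        exact hv.apply_eq_smul
      have : Nontrivial (LinearMap.ker f) :=
        ⟨⟨v, this⟩, 0, fun h => hv.2 (congrArg Subtype.val h)⟩
      have : Module.Finite ℝ (LinearMap.ker f) :=
        inferInstanceAs (Module.Finite ℝ (LinearMap.ker (f.restrictScalars ℝ)))
      exact Module.finrank_pos
    have hpos' : 0 < Module.finrank ℝ (LinearMap.range f) := by
      obtain ⟨m, hm⟩ := hb r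
      have : Nontrivial (LinearMap.range f) :=
        ⟨⟨f m, m, rfl⟩, 0, fun h => hm (by
          have := congrArg Subtype.val h
          simpa [hf, sub_eq_zero] using this)⟩
      have : Module.Finite ℝ (LinearMap.range f) :=
        inferInstanceAs (Module.Finite ℝ (LinearMap.range (f.restrictScalars ℝ)))
      exact Module.finrank_pos
    rcases Nat.even_or_odd (Module.finrank ℝ (LinearMap.range f)) with he | ho
    · refine ih _ ?_ (LinearMap.ker f) rfl ?_
      · omega
      · rw [← hsum] at hodd
        exact (Nat.odd_add'.1 hodd).2 he
    · exact ih _ (by omega) (LinearMap.range f) rfl ho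

/-- A countable set of bad parameters leaves arbitrarily large good ones; the images of the
variables under a real character of the quotient are the coordinates of a zero. -/
lemma exists_zero_deformedPower {σ : Type*} [Fintype σ] {f : σ → MvPolynomial σ ℝ} {d : ℕ}
    (hd : Odd d) (hf : ∀ j, (f j).totalDegree ≤ d) (N : ℝ) :
    ∃ t > N, ∃ x : σ → ℝ, ∀ j, x j ^ d + t * eval x (f j) = 0 := by
  classical
  obtain ⟨S, hS, hSt⟩ := countable_finrank_quotient_ne hf
  obtain ⟨t, htS, ht⟩ := (hS.dense_compl ℝ).exists_gt N
  refine ⟨t, ht, ?_⟩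
  obtain ⟨χ⟩ := nonempty_algHom_of_odd_finrank_module
    (B := MvPolynomial σ ℝ ⧸ Ideal.span (Set.range (deformedPower f d t))) _ _ (hSt t htS) hd.pow
  let φ := χ.comp (Ideal.Quotient.mkₐ ℝ _)
  have hφ : φ = aeval fun j => φ (X j) := (aeval_unique φ)
  refine ⟨fun j => φ (X j), fun j => ?_⟩
  have h1 : φ (deformedPower f d t j) = 0 := by
    have : Ideal.Quotient.mkₐ ℝ (Ideal.span (Set.range (deformedPower f d t)))
      (deformedPower f d t j) = 0 := Ideal.Quotient.eq_zero_iff_mem.2 (Ideal.subset_span ⟨j, rfl⟩)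
    rw [AlgHom.comp_apply, this, map_zero]
  rw [deformedPower, map_add, map_pow, map_smul, smul_eq_mul] at h1
  rw [← h1, ← coe_aeval_eq_eval]
  congr 2
  exact (DFunLike.congr_fun hφ (f j)).symm

lemma totalDegree_aeval_le {σ τ R : Type*} [CommRing R] {g : σ → MvPolynomial τ R}
    (hg : ∀ i, (g i).totalDegree ≤ 1) (p : MvPolynomial σ R) :
    (aeval g p).totalDegree ≤ p.totalDegree := by
  rw [aeval_def, eval₂_eq]
  refine totalDegree_finsetSum_le fun e he => ?_
  rw [algebraMap_eq]
  refine (totalDegree_mul _ _).trans ?_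
  rw [totalDegree_C, zero_add]
  refine (totalDegree_finsetProd _ _).trans (le_trans ?_ (le_totalDegree he))
  refine Finset.sum_le_sum fun i _ => (totalDegree_pow _ _).trans ?_
  exact (Nat.mul_le_mul_left _ (hg i)).trans_eq (mul_one _)

lemma eval_smul_of_isHomogeneous {σ R : Type*} [CommRing R] {p : MvPolynomial σ R} {d : ℕ}
    (hp : p.IsHomogeneous d) (r : R) (x : σ → R) : eval (r • x) p = r ^ d * eval x p := by
  rw [eval_eq, eval_eq, Finset.mul_sum]
  refine Finset.sum_congr rfl fun e he => ?_
  have : e.sum (fun _ n => n) = d := by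
    rw [← hp (mem_support_iff.1 he), Finsupp.weight_apply]
    simp
  simp only [Pi.smul_apply, smul_eq_mul, mul_pow, Finset.prod_mul_distrib]
  rw [Finset.prod_pow_eq_pow_sum, ← this, Finsupp.sum]
  ring

end HamSandwichOpt

/-! ### Borsuk–Ulam through forms of odd degree. -/

namespace HamSandwichOpt

open MvPolynomial

/-- `n` forms of odd degree in `n + 1` variables have approximate common zeros on the sphere. -/
lemma exists_mem_sphere_abs_eval_lt {n d : ℕ} (hd : Odd d)
    (h : Fin n → MvPolynomial (Fin (n + 1)) ℝ) (hh : ∀ j, (h j).IsHomogeneous d) {ε : ℝ}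
    (hε : 0 < ε) :
    ∃ y ∈ Metric.sphere (0 : EuclideanSpace ℝ (Fin (n + 1))) 1, ∀ j, |eval y.ofLp (h j)| < ε := by
  -- Dehomogenize by setting the zeroth variable to `1`; this also keeps the resulting point `(1,
  -- x)` away from the origin.
  let g : Fin (n + 1) → MvPolynomial (Fin n) ℝ := Fin.cons 1 X
  have hg : ∀ i, (g i).totalDegree ≤ 1 := by
    intro i
    refine Fin.cases ?_ (fun i => ?_) i <;> simp [g]
  obtain ⟨t, ht, x, hx⟩ := exists_zero_deformedPower (f := fun j => aeval g (h j)) hd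
    (fun j => (totalDegree_aeval_le hg _).trans (hh j).totalDegree_le) ε⁻¹
  have ht0 : 0 < t := (inv_pos.2 hε).trans ht
  set z : EuclideanSpace ℝ (Fin (n + 1)) := WithLp.toLp 2 (Fin.cons 1 x : Fin (n + 1) → ℝ) with hz
  have hzc : ∀ i, |z i| ≤ ‖z‖ := fun i => by simpa using PiLp.norm_apply_le z i
  have hr : 0 < ‖z‖ := by
    have := hzc 0
    rw [hz] at this ⊢
    simp only [Fin.cons_zero, abs_one] at this
    linarith
  have heval : ∀ j, eval x (aeval g (h j)) = eval z.ofLp (h j) := by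
    intro j
    rw [← coe_aeval_eq_eval, ← coe_aeval_eq_eval]
    refine (DFunLike.congr_fun (comp_aeval g (aeval x)) (h j)).trans ?_
    simp only [RingHom.coe_coe]
    congr 2
    funext i
    refine Fin.cases ?_ (fun i => ?_) i <;> simp [g, hz]
  refine ⟨‖z‖⁻¹ • z, ?_, fun j => ?_⟩
  · rw [mem_sphere_zero_iff_norm, norm_smul, norm_inv, norm_norm, inv_mul_cancel₀ hr.ne']
  · rw [WithLp.ofLp_smul, eval_smul_of_isHomogeneous (hh j), ← heval]
    have h1 : eval x (aeval g (h j)) = -(x j ^ d * t⁻¹) := by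
      have := hx j
      field_simp
      linarith
    have hxz : |x j| ≤ ‖z‖ := by simpa [hz] using hzc j.succ
    rw [h1, abs_mul, abs_neg, abs_mul, abs_pow, abs_pow, abs_inv, abs_inv, abs_norm, abs_of_pos ht0]
    calc ‖z‖⁻¹ ^ d * (|x j| ^ d * t⁻¹) ≤ ‖z‖⁻¹ ^ d * (‖z‖ ^ d * t⁻¹) := by gcongr
      _ = t⁻¹ := by rw [← mul_assoc, ← mul_pow, inv_mul_cancel₀ hr.ne', one_pow, one_mul]
      _ < ε := inv_lt_of_inv_lt₀ hε ht

/-- The odd part of a polynomial, made homogeneous by powers of the squared norm. -/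
noncomputable def oddForm {σ : Type*} [Fintype σ] (p : MvPolynomial σ ℝ) (N : ℕ) :
    MvPolynomial σ ℝ :=
  ∑ i ∈ Finset.range (N + 1), homogeneousComponent (2 * i + 1) p * (∑ k, X k ^ 2) ^ (N - i)

lemma isHomogeneous_oddForm {σ : Type*} [Fintype σ] (p : MvPolynomial σ ℝ) (N : ℕ) :
    (oddForm p N).IsHomogeneous (2 * N + 1) := by
  refine IsHomogeneous.sum _ _ _ fun i hi => ?_
  have h1 : (∑ k : σ, (X k : MvPolynomial σ ℝ) ^ 2).IsHomogeneous 2 :=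
    IsHomogeneous.sum _ _ _ fun k _ => isHomogeneous_X_pow k 2
  have h2 := (homogeneousComponent_isHomogeneous (2 * i + 1) p).mul (h1.pow (N - i))
  rw [Finset.mem_range] at hi
  convert h2 using 1
  omega

/-- On the sphere the homogenizing factors equal `1`, and taking the odd part cancels the components
of even degree. -/
lemma eval_oddForm {n : ℕ} (p : MvPolynomial (Fin n) ℝ) {N : ℕ} (hp : p.totalDegree ≤ 2 * N + 1)
    {y : EuclideanSpace ℝ (Fin n)} (hy : y ∈ Metric.sphere (0 : EuclideanSpace ℝ (Fin n)) 1) :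
    eval y.ofLp (oddForm p N) = (eval y.ofLp p - eval (-y).ofLp p) / 2 := by
  have hsum : ∀ x : Fin n → ℝ, eval x p =
      ∑ k ∈ Finset.range (2 * (N + 1)), eval x (homogeneousComponent k p) := by
    intro x
    conv_lhs => rw [← sum_homogeneousComponent p]
    rw [map_sum]
    refine Finset.sum_subset (Finset.range_subset_range.2 (by omega)) fun k _ hk => ?_
    rw [Finset.mem_range] at hk
    rw [homogeneousComponent_eq_zero _ _ (by omega), map_zero]
  have hpair : ∀ (g : ℕ → ℝ) (M : ℕ), ∑ k ∈ Finset.range (2 * M), g k =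
      ∑ i ∈ Finset.range M, (g (2 * i) + g (2 * i + 1)) := by
    intro g M
    induction M with
    | zero => simp
    | succ M ih => rw [Finset.sum_range_succ, ← ih, mul_add, mul_one, Finset.sum_range_succ,
        Finset.sum_range_succ, add_assoc]
  have hnorm : ∑ k, y.ofLp k ^ 2 = 1 := by
    rw [mem_sphere_zero_iff_norm] at hy
    rw [← EuclideanSpace.real_norm_sq_eq, hy, one_pow]
  have hneg : (-y).ofLp = (-1 : ℝ) • y.ofLp := by simp
  rw [hsum, hsum, hpair, hpair, ← Finset.sum_sub_distrib, Finset.sum_div, oddForm, map_sum]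
  refine Finset.sum_congr rfl fun i _ => ?_
  rw [hneg, eval_smul_of_isHomogeneous (homogeneousComponent_isHomogeneous _ _),
    eval_smul_of_isHomogeneous (homogeneousComponent_isHomogeneous _ _)]
  have he : (-1 : ℝ) ^ (2 * i) = 1 := (even_two_mul i).neg_one_pow
  simp only [map_mul, map_pow, map_sum, eval_X, hnorm, one_pow, pow_succ (-1 : ℝ) (2 * i), he]
  ring

/-- Weierstrass approximation on the unit sphere. -/
lemma exists_eval_near_of_continuousOn_sphere {n : ℕ} {f : EuclideanSpace ℝ (Fin n) → ℝ}
    (hf : ContinuousOn f (Metric.sphere 0 1)) {ε : ℝ} (hε : 0 < ε) :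
    ∃ p : MvPolynomial (Fin n) ℝ, ∀ y ∈ Metric.sphere (0 : EuclideanSpace ℝ (Fin n)) 1,
      |eval y.ofLp p - f y| < ε := by
  let S := Metric.sphere (0 : EuclideanSpace ℝ (Fin n)) 1
  let c : Fin n → C(S, ℝ) := fun i => ⟨fun y => y.1 i, by fun_prop⟩
  have hsep : (aeval (R := ℝ) c).range.SeparatesPoints := by
    intro y z hyz
    obtain ⟨i, hi⟩ : ∃ i, y.1 i ≠ z.1 i := by
      by_contra! h
      exact hyz (Subtype.ext (PiLp.ext h))
    exact ⟨c i, ⟨c i, ⟨X i, by simp⟩, rfl⟩, hi⟩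
  obtain ⟨⟨_, p, rfl⟩, hp⟩ :=
    ContinuousMap.exists_mem_subalgebra_near_continuous_of_separatesPoints _ hsep
      (S.domRestrict f) hf.domRestrict ε hε
  refine ⟨p, fun y hy => ?_⟩
  have h1 := hp ⟨y, hy⟩
  have h2 : (aeval c p) ⟨y, hy⟩ = eval y.ofLp p := by
    have := DFunLike.congr_fun (comp_aeval c (ContinuousMap.evalAlgHom ℝ ℝ (⟨y, hy⟩ : S))) p
    rw [← coe_aeval_eq_eval]
    exact this
  rw [Real.norm_eq_abs] at h1
  rw [← h2]
  exact h1

/-- The Borsuk–Ulam theorem. -/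
theorem exists_zero_of_odd_continuousOn_sphere {n : ℕ}
    (F : EuclideanSpace ℝ (Fin (n + 1)) → Fin n → ℝ) (hF : ContinuousOn F (Metric.sphere 0 1))
    (hodd : ∀ y ∈ Metric.sphere (0 : EuclideanSpace ℝ (Fin (n + 1))) 1, F (-y) = -F y) :
    ∃ y ∈ Metric.sphere (0 : EuclideanSpace ℝ (Fin (n + 1))) 1, F y = 0 := by
  have hne : (Metric.sphere (0 : EuclideanSpace ℝ (Fin (n + 1))) 1).Nonempty :=
    NormedSpace.sphere_nonempty.2 zero_le_one
  obtain ⟨y, hy, hmin⟩ := (isCompact_sphere _ _).exists_isMinOn hne hF.norm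
  refine ⟨y, hy, ?_⟩
  by_contra hne0
  -- Half the minimum of `‖F‖`: one `ε` pays for approximating `F` by the odd part, the other for
  -- the approximate zero of that odd part.
  set ε := ‖F y‖ / 2
  have hε : 0 < ε := half_pos (norm_pos_iff.2 hne0)
  choose p hp using fun j => exists_eval_near_of_continuousOn_sphere
    (f := fun y => F y j) (continuousOn_pi.1 hF j) hε
  set N := Finset.univ.sup fun j => (p j).totalDegree
  have hN : ∀ j, (p j).totalDegree ≤ 2 * N + 1 := fun j => by
    have : (p j).totalDegree ≤ N :=
      Finset.le_sup (f := fun j => (p j).totalDegree) (Finset.mem_univ j)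
    omega
  obtain ⟨z, hz, hzε⟩ := exists_mem_sphere_abs_eval_lt (odd_two_mul_add_one N)
    (fun j => oddForm (p j) N) (fun j => isHomogeneous_oddForm _ _) hε
  have hz' : -z ∈ Metric.sphere (0 : EuclideanSpace ℝ (Fin (n + 1))) 1 := by simpa using hz
  have hlt : ‖F z‖ < 2 * ε := by
    rw [pi_norm_lt_iff (by positivity)]
    intro j
    have h1 := hp j z hz
    have h2 := hp j (-z) hz'
    have h3 := hzε j
    rw [eval_oddForm _ (hN j) hz] at h3
    rw [hodd z hz, Pi.neg_apply] at h2
    rw [Real.norm_eq_abs]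
    rw [abs_lt] at *
    constructor <;> linarith
  have h4 : ‖F y‖ ≤ ‖F z‖ := hmin hz
  simp only [ε] at hlt
  linarith

end HamSandwichOpt

/-! ### Continuity of the spread, and exclusion of degenerate hyperplanes. -/

namespace HamSandwichOpt

open Filter Topology

section Spread

variable {n : ℕ}

lemma continuous_firstPart :
    Continuous (firstPart : EuclideanSpace ℝ (Fin (n + 1)) → EuclideanSpace ℝ (Fin n)) := by
  unfold firstPart
  fun_prop

lemma continuous_lastPart : Continuous (lastPart : EuclideanSpace ℝ (Fin (n + 1)) → ℝ) := by
  unfold lastPart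
  fun_prop

lemma firstPart_neg (u : EuclideanSpace ℝ (Fin (n + 1))) : firstPart (-u) = -firstPart u := rfl

lemma lastPart_neg (u : EuclideanSpace ℝ (Fin (n + 1))) : lastPart (-u) = -lastPart u := rfl

lemma eq_zero_of_firstPart_lastPart {u : EuclideanSpace ℝ (Fin (n + 1))} (h1 : firstPart u = 0)
    (h2 : lastPart u = 0) : u = 0 := by
  ext i
  refine Fin.lastCases h2 (fun j => ?_) i
  exact congrArg (fun v : EuclideanSpace ℝ (Fin n) => v j) h1

lemma Hplus_neg (u : EuclideanSpace ℝ (Fin (n + 1))) : Hplus (-u) = Hminus u := by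
  ext x
  simp [Hplus, Hminus, firstPart_neg, lastPart_neg]

variable (Q : Matrix (Fin n) (Fin n) ℝ)

lemma continuous_bilinearObjective :
    Continuous fun p : EuclideanSpace ℝ (Fin n) × EuclideanSpace ℝ (Fin (n + 1)) =>
      bilinearObjective Q p.1 p.2 := by
  unfold bilinearObjective
  have h1 : Continuous fun p : EuclideanSpace ℝ (Fin n) × EuclideanSpace ℝ (Fin (n + 1)) =>
      (WithLp.toLp 2 (Q.mulVec p.1) : EuclideanSpace ℝ (Fin n)) := by
    refine (PiLp.continuous_toLp 2 _).comp (Continuous.matrix_mulVec continuous_const ?_)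
    fun_prop
  exact (continuous_firstPart.comp continuous_snd).inner h1

lemma continuous_bilinearObjective_comp {T : Type*} [TopologicalSpace T]
    {p : T → EuclideanSpace ℝ (Fin n)} {v : T → EuclideanSpace ℝ (Fin (n + 1))}
    (hp : Continuous p) (hv : Continuous v) :
    Continuous fun t => bilinearObjective Q (p t) (v t) :=
  (continuous_bilinearObjective Q).comp (hp.prodMk hv)

lemma bilinearObjective_neg (x : EuclideanSpace ℝ (Fin n)) (u : EuclideanSpace ℝ (Fin (n + 1))) :
    bilinearObjective Q x (-u) = -bilinearObjective Q x u := by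
  rw [bilinearObjective, firstPart_neg, inner_neg_left]
  rfl

lemma bilinearObjective_add_smul (x v : EuclideanSpace ℝ (Fin n)) (s : ℝ)
    (u : EuclideanSpace ℝ (Fin (n + 1))) :
    bilinearObjective Q (x + s • v) u = bilinearObjective Q x u + s * bilinearObjective Q v u := by
  simp only [bilinearObjective]
  rw [WithLp.ofLp_add, WithLp.ofLp_smul, Matrix.mulVec_add, Matrix.mulVec_smul, WithLp.toLp_add,
    WithLp.toLp_smul, inner_add_right, inner_smul_right]

/-- The spread of the objective on `A ∩ H⁺`, with value `0` when this set is empty. -/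
noncomputable def plusSpread (A : Set (EuclideanSpace ℝ (Fin n)))
    (u : EuclideanSpace ℝ (Fin (n + 1))) : ℝ :=
  sSup (insert 0 (Set.image2 (fun x y => bilinearObjective Q x u - bilinearObjective Q y u)
    (A ∩ Hplus u) (A ∩ Hplus u)))

variable {Q} {A : Set (EuclideanSpace ℝ (Fin n))} {u : EuclideanSpace ℝ (Fin (n + 1))}

lemma plusSpread_le {c : ℝ} (hc : 0 ≤ c) (h : ∀ x ∈ A ∩ Hplus u, ∀ y ∈ A ∩ Hplus u,
    bilinearObjective Q x u - bilinearObjective Q y u ≤ c) : plusSpread Q A u ≤ c := by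
  refine csSup_le (Set.insert_nonempty _ _) ?_
  rintro _ (rfl | ⟨x, hx, y, hy, rfl⟩)
  exacts [hc, h x hx y hy]

lemma bddAbove_spreadSet (hA : IsCompact A) :
    BddAbove (insert 0 (Set.image2
      (fun x y => bilinearObjective Q x u - bilinearObjective Q y u)
      (A ∩ Hplus u) (A ∩ Hplus u))) := by
  have hc : Continuous fun x => bilinearObjective Q x u :=
    continuous_bilinearObjective_comp Q continuous_id continuous_const
  obtain ⟨M, hM⟩ := (hA.image hc).bddAbove
  obtain ⟨m, hm⟩ := (hA.image hc).bddBelow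
  refine BddAbove.insert 0 ⟨M - m, ?_⟩
  rintro _ ⟨x, hx, y, hy, rfl⟩
  exact sub_le_sub (hM ⟨x, hx.1, rfl⟩) (hm ⟨y, hy.1, rfl⟩)

lemma sub_le_plusSpread (hA : IsCompact A) {x y : EuclideanSpace ℝ (Fin n)}
    (hx : x ∈ A ∩ Hplus u) (hy : y ∈ A ∩ Hplus u) :
    bilinearObjective Q x u - bilinearObjective Q y u ≤ plusSpread Q A u :=
  le_csSup (bddAbove_spreadSet hA) (Set.mem_insert_of_mem _ ⟨x, hx, y, hy, rfl⟩)

lemma plusSpread_nonneg (hA : IsCompact A) : 0 ≤ plusSpread Q A u :=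
  le_csSup (bddAbove_spreadSet hA) (Set.mem_insert _ _)

lemma plusSpread_eq_zero_of_eq_empty (hA : IsCompact A) (h : A ∩ Hplus u = ∅) :
    plusSpread Q A u = 0 :=
  le_antisymm (plusSpread_le le_rfl (by simp [h])) (plusSpread_nonneg hA)

lemma isClosed_Hplus : IsClosed (Hplus u) :=
  isClosed_le continuous_const (continuous_const.inner continuous_id)

lemma isSpread_plusSpread (hA : IsCompact A) (h : (A ∩ Hplus u).Nonempty) :
    IsSpread (fun x => bilinearObjective Q x u) (A ∩ Hplus u) (plusSpread Q A u) := by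
  have hc : Continuous fun x => bilinearObjective Q x u :=
    continuous_bilinearObjective_comp Q continuous_id continuous_const
  have hK := (hA.inter_right (isClosed_Hplus (u := u))).image hc
  obtain ⟨M, hM⟩ := hK.exists_isGreatest (h.image _)
  obtain ⟨m, hm⟩ := hK.exists_isLeast (h.image _)
  refine ⟨M, m, hM, hm, le_antisymm (plusSpread_le ?_ ?_) ?_⟩
  · exact sub_nonneg.2 (hM.2 hm.1)
  · exact fun x hx y hy => sub_le_sub (hM.2 ⟨x, hx, rfl⟩) (hm.2 ⟨y, hy, rfl⟩)
  · obtain ⟨x, hx, rfl⟩ := hM.1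
    obtain ⟨y, hy, rfl⟩ := hm.1
    exact sub_le_plusSpread hA hx hy

lemma IsSpread.neg {g : EuclideanSpace ℝ (Fin n) → ℝ} {S : Set (EuclideanSpace ℝ (Fin n))} {d : ℝ}
    (h : IsSpread (fun x => -g x) S d) : IsSpread g S d := by
  obtain ⟨M, m, ⟨⟨x, hx, rfl⟩, hM⟩, ⟨⟨y, hy, rfl⟩, hm⟩, rfl⟩ := h
  refine ⟨g y, g x, ⟨⟨y, hy, rfl⟩, ?_⟩, ⟨⟨x, hx, rfl⟩, ?_⟩, by ring⟩
  · rintro _ ⟨z, hz, rfl⟩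
    exact neg_le_neg_iff.1 (hm ⟨z, hz, rfl⟩)
  · rintro _ ⟨z, hz, rfl⟩
    exact neg_le_neg_iff.1 (hM ⟨z, hz, rfl⟩)

lemma isSpread_plusSpread_neg (hA : IsCompact A) (h : (A ∩ Hminus u).Nonempty) :
    IsSpread (fun x => bilinearObjective Q x u) (A ∩ Hminus u) (plusSpread Q A (-u)) := by
  rw [← Hplus_neg] at h ⊢
  have := isSpread_plusSpread (Q := Q) hA h
  simp only [bilinearObjective_neg] at this
  exact this.neg

/-- Upper semicontinuity needs only compactness of `A`: each pair of points either leaves `H⁺`,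
which is an open condition, or has objective difference below `c` nearby. -/
lemma eventually_plusSpread_lt (hA : IsCompact A) {b : ℝ} (hb : plusSpread Q A u < b) :
    ∀ᶠ v in 𝓝 u, plusSpread Q A v < b := by
  obtain ⟨c, hc, hcb⟩ := exists_between hb
  have key : ∀ᶠ v in 𝓝 u, ∀ p ∈ A ×ˢ A, p.1 ∈ Hplus v → p.2 ∈ Hplus v →
      bilinearObjective Q p.1 v - bilinearObjective Q p.2 v < c := by
    refine (hA.prod hA).eventually_forall_of_forall_eventually fun p hp => ?_
    have hH : ∀ (π : EuclideanSpace ℝ (Fin n) × EuclideanSpace ℝ (Fin n) →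
        EuclideanSpace ℝ (Fin n)), Continuous π → π p ∉ Hplus u →
        ∀ᶠ z : EuclideanSpace ℝ (Fin (n + 1)) × _ in 𝓝 (u, p), π z.2 ∉ Hplus z.1 := by
      intro π hπ hp
      have : IsOpen {z : EuclideanSpace ℝ (Fin (n + 1)) ×
          (EuclideanSpace ℝ (Fin n) × EuclideanSpace ℝ (Fin n)) | π z.2 ∉ Hplus z.1} := by
        simp only [Hplus, Set.mem_ofPred_eq, not_le]
        exact isOpen_lt ((continuous_firstPart.comp continuous_fst).inner
          (hπ.comp continuous_snd)) (continuous_lastPart.comp continuous_fst)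
      exact this.mem_nhds hp
    by_cases h1 : p.1 ∈ Hplus u
    · by_cases h2 : p.2 ∈ Hplus u
      · have hopen : IsOpen {z : EuclideanSpace ℝ (Fin (n + 1)) ×
            (EuclideanSpace ℝ (Fin n) × EuclideanSpace ℝ (Fin n)) |
            bilinearObjective Q z.2.1 z.1 - bilinearObjective Q z.2.2 z.1 < c} :=
          isOpen_lt ((continuous_bilinearObjective_comp Q
            (continuous_fst.comp continuous_snd) continuous_fst).sub
            (continuous_bilinearObjective_comp Q
            (continuous_snd.comp continuous_snd) continuous_fst)) continuous_const
        have hmem : bilinearObjective Q p.1 u - bilinearObjective Q p.2 u < c :=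
          (sub_le_plusSpread hA ⟨hp.1, h1⟩ ⟨hp.2, h2⟩).trans_lt hc
        filter_upwards [hopen.mem_nhds (x := (u, p)) hmem] with z hz _ _ using hz
      · filter_upwards [hH Prod.snd continuous_snd h2] with z hz _ h using absurd h hz
    · filter_upwards [hH Prod.fst continuous_fst h1] with z hz h using absurd h hz
  filter_upwards [key] with v hv
  refine (plusSpread_le ((plusSpread_nonneg hA).trans hc.le) fun x hx y hy => ?_).trans_lt hcb
  exact (hv (x, y) ⟨hx.1, hy.1⟩ hx.2 hy.2).le

/-- If every supporting hyperplane meets `A` in one point, then `A ∩ H⁺` is a subsingleton unless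
`A` has a point in the open half-space. -/
lemma exists_lt_inner_of_ne (hu : u ≠ 0) (hclosed : IsClosed A)
    (hsupp : ∀ x ∈ frontier A, ∀ H, IsSupportingHyperplaneAt H A x → ∃ y, A ∩ H = {y})
    {x y : EuclideanSpace ℝ (Fin n)} (hx : x ∈ A ∩ Hplus u) (hy : y ∈ A ∩ Hplus u) (hxy : x ≠ y) :
    ∃ w ∈ A, lastPart u < inner ℝ (firstPart u) w := by
  by_contra! hle
  have hval : ∀ z ∈ A ∩ Hplus u, inner ℝ (firstPart u) z = lastPart u :=
    fun z hz => le_antisymm (hle z hz.1) hz.2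
  have hfirst : firstPart u ≠ 0 := by
    intro h0
    have := hval x hx
    rw [h0, inner_zero_left] at this
    exact hu (eq_zero_of_firstPart_lastPart h0 this.symm)
  have hfr : x ∈ frontier A := by
    rw [hclosed.frontier_eq]
    -- From an interior point, a small step along `firstPart u` would stay in `A` and cross the
    -- hyperplane.
    refine ⟨hx.1, fun hxi => ?_⟩
    have ht : Tendsto (fun s : ℝ => x + s • firstPart u) (𝓝[>] 0) (𝓝 x) := by
      have : Continuous fun s : ℝ => x + s • firstPart u := by fun_prop
      simpa using (this.tendsto 0).mono_left nhdsWithin_le_nhds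
    obtain ⟨s, hsA, hs⟩ := ((ht.eventually (mem_interior_iff_mem_nhds.1 hxi)).and
      self_mem_nhdsWithin).exists
    have h1 := hle _ hsA
    rw [inner_add_right, hval x hx, inner_smul_right] at h1
    have h2 : 0 < inner ℝ (firstPart u) (firstPart u) := real_inner_self_pos.2 hfirst
    have h3 := mul_pos (Set.mem_Ioi.1 hs) h2
    linarith
  obtain ⟨z, hz⟩ := hsupp x hfr {y | inner ℝ (firstPart u) y = inner ℝ (firstPart u) x}
    ⟨hx.1, firstPart u, hfirst, rfl, fun y hy => (hle y hy).trans_eq (hval x hx).symm⟩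
  have h1 : x ∈ ({z} : Set _) := hz ▸ ⟨hx.1, rfl⟩
  have h2 : y ∈ ({z} : Set _) := hz ▸ ⟨hy.1, (hval y hy).trans (hval x hx).symm⟩
  exact hxy (h1.trans h2.symm)

lemma mem_and_lt_inner_of_Ioo (hconv : Convex ℝ A) {z w : EuclideanSpace ℝ (Fin n)}
    (hz : z ∈ A ∩ Hplus u) (hwA : w ∈ A) (hw : lastPart u < inner ℝ (firstPart u) w) {s : ℝ}
    (hs : s ∈ Set.Ioo (0 : ℝ) 1) :
    z + s • (w - z) ∈ A ∧ lastPart u < inner ℝ (firstPart u) (z + s • (w - z)) := by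
  refine ⟨hconv.add_smul_sub_mem hz.1 hwA ⟨hs.1.le, hs.2.le⟩, ?_⟩
  have hz2 : lastPart u ≤ inner ℝ (firstPart u) z := hz.2
  rw [inner_add_right, inner_smul_right, inner_sub_right]
  have h1 := mul_lt_mul_of_pos_left hw hs.1
  have h2 := mul_le_mul_of_nonneg_left hz2 (sub_nonneg.2 hs.2.le)
  linarith

/-- Sliding both points slightly towards `w` puts them strictly inside the half-space, where they
remain when `u` is perturbed. -/
lemma exists_pair_lt_inner (hconv : Convex ℝ A) {x y w : EuclideanSpace ℝ (Fin n)}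
    (hx : x ∈ A ∩ Hplus u) (hy : y ∈ A ∩ Hplus u) (hwA : w ∈ A)
    (hw : lastPart u < inner ℝ (firstPart u) w) {a : ℝ}
    (ha : a < bilinearObjective Q x u - bilinearObjective Q y u) :
    ∃ x' ∈ A, ∃ y' ∈ A, lastPart u < inner ℝ (firstPart u) x' ∧
      lastPart u < inner ℝ (firstPart u) y' ∧
      a < bilinearObjective Q x' u - bilinearObjective Q y' u := by
  have hray : ∀ z : EuclideanSpace ℝ (Fin n), Continuous fun s : ℝ => z + s • (w - z) :=
    fun z => by fun_prop
  have hobj : Continuous fun s : ℝ => bilinearObjective Q (x + s • (w - x)) u -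
      bilinearObjective Q (y + s • (w - y)) u :=
    (continuous_bilinearObjective_comp Q (hray x) continuous_const).sub
      (continuous_bilinearObjective_comp Q (hray y) continuous_const)
  have hnear : ∀ᶠ s in 𝓝 (0 : ℝ), a < bilinearObjective Q (x + s • (w - x)) u -
      bilinearObjective Q (y + s • (w - y)) u := by
    refine (hobj.tendsto 0).eventually_const_lt ?_
    simpa only [zero_smul, add_zero] using ha
  obtain ⟨s, hs, hsI⟩ := ((hnear.filter_mono nhdsWithin_le_nhds).and
    (Ioo_mem_nhdsGT (zero_lt_one (α := ℝ)))).exists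
  obtain ⟨hxA, hxs⟩ := mem_and_lt_inner_of_Ioo hconv hx hwA hw hsI
  obtain ⟨hyA, hys⟩ := mem_and_lt_inner_of_Ioo hconv hy hwA hw hsI
  exact ⟨_, hxA, _, hyA, hxs, hys, hs⟩

lemma eventually_mem_Hplus {z : EuclideanSpace ℝ (Fin n)}
    (hz : lastPart u < inner ℝ (firstPart u) z) : ∀ᶠ v in 𝓝 u, z ∈ Hplus v := by
  filter_upwards [(isOpen_lt continuous_lastPart
    (continuous_firstPart.inner continuous_const)).mem_nhds hz] with v hv using le_of_lt hv

/-- Lower semicontinuity is where the singleton hypothesis enters: a positive spread requires two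
points, hence a point of `A` in the open half-space. -/
lemma eventually_lt_plusSpread (hu : u ≠ 0) (hA : IsCompact A) (hconv : Convex ℝ A)
    (hsupp : ∀ x ∈ frontier A, ∀ H, IsSupportingHyperplaneAt H A x → ∃ y, A ∩ H = {y})
    {a : ℝ} (ha : a < plusSpread Q A u) : ∀ᶠ v in 𝓝 u, a < plusSpread Q A v := by
  rcases lt_or_ge a 0 with h0 | h0
  · exact Eventually.of_forall fun v => h0.trans_le (plusSpread_nonneg hA)
  obtain ⟨x, hx, y, hy, har⟩ : ∃ x ∈ A ∩ Hplus u, ∃ y ∈ A ∩ Hplus u,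
      a < bilinearObjective Q x u - bilinearObjective Q y u := by
    by_contra! h
    exact ha.not_ge (plusSpread_le h0 h)
  obtain ⟨w, hwA, hw⟩ := exists_lt_inner_of_ne hu hA.isClosed hsupp hx hy (by
    rintro rfl
    rw [sub_self] at har
    exact h0.not_gt har)
  obtain ⟨x', hxA, y', hyA, hxs, hys, hs⟩ := exists_pair_lt_inner hconv hx hy hwA hw har
  have hcont : Continuous fun v => bilinearObjective Q x' v - bilinearObjective Q y' v :=
    (continuous_bilinearObjective_comp Q continuous_const continuous_id).sub
      (continuous_bilinearObjective_comp Q continuous_const continuous_id)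
  filter_upwards [eventually_mem_Hplus hxs, eventually_mem_Hplus hys,
    (hcont.tendsto u).eventually_const_lt hs] with v h1 h2 h3
  exact lt_of_lt_of_le h3 (sub_le_plusSpread hA ⟨hxA, h1⟩ ⟨hyA, h2⟩)

lemma continuousAt_plusSpread (hu : u ≠ 0) (hA : IsCompact A) (hconv : Convex ℝ A)
    (hsupp : ∀ x ∈ frontier A, ∀ H, IsSupportingHyperplaneAt H A x → ∃ y, A ∩ H = {y}) :
    ContinuousAt (plusSpread Q A) u :=
  tendsto_order.2 ⟨fun _ ha => eventually_lt_plusSpread hu hA hconv hsupp ha,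
    fun _ hb => eventually_plusSpread_lt hA hb⟩

lemma exists_bilinearObjective_lt (hint : (interior A).Nonempty) (hQ : IsUnit Q)
    (hu : firstPart u ≠ 0) :
    ∃ x ∈ A, ∃ y ∈ A, bilinearObjective Q x u < bilinearObjective Q y u := by
  obtain ⟨z, hz⟩ := hint
  -- In this direction the objective grows at rate `‖firstPart u‖ ^ 2`.
  let v : EuclideanSpace ℝ (Fin n) := WithLp.toLp 2 (Q⁻¹.mulVec (firstPart u))
  have hv : bilinearObjective Q v u = inner ℝ (firstPart u) (firstPart u) := by
    simp only [bilinearObjective, v]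
    rw [Matrix.mulVec_mulVec, Matrix.mul_nonsing_inv _ ((Matrix.isUnit_iff_isUnit_det _).1 hQ),
      Matrix.one_mulVec]
  have ht : Tendsto (fun s : ℝ => z + s • v) (𝓝[>] 0) (𝓝 z) := by
    have : Continuous fun s : ℝ => z + s • v := by fun_prop
    simpa using (this.tendsto 0).mono_left nhdsWithin_le_nhds
  obtain ⟨s, hsA, hs⟩ := ((ht.eventually (mem_interior_iff_mem_nhds.1 hz)).and
    self_mem_nhdsWithin).exists
  refine ⟨z, interior_subset hz, _, hsA, ?_⟩
  rw [bilinearObjective_add_smul, hv]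
  exact lt_add_of_pos_right _ (mul_pos hs (real_inner_self_pos.2 hu))

/-- If `H⁺` missed `A`, then `H⁻` would contain it, and the positive spread of all of `A` would
equal `0`. -/
lemma nonempty_inter_Hplus_of_plusSpread_eq (hA : IsCompact A) (hint : (interior A).Nonempty)
    (hQ : IsUnit Q) (hu : firstPart u ≠ 0) (h : plusSpread Q A u = plusSpread Q A (-u)) :
    (A ∩ Hplus u).Nonempty := by
  by_contra hempty
  rw [Set.not_nonempty_iff_eq_empty] at hempty
  rw [plusSpread_eq_zero_of_eq_empty hA hempty] at h
  have hmem : ∀ x ∈ A, x ∈ A ∩ Hplus (-u) := fun x hx => by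
    refine ⟨hx, Hplus_neg u ▸ ?_⟩
    by_contra hxm
    have : x ∈ A ∩ Hplus u := ⟨hx, show lastPart u ≤ _ from (not_le.1 hxm).le⟩
    simp [hempty] at this
  obtain ⟨x, hx, y, hy, hxy⟩ := exists_bilinearObjective_lt hint hQ hu
  have := sub_le_plusSpread (Q := Q) hA (hmem x hx) (hmem y hy)
  rw [← h, bilinearObjective_neg, bilinearObjective_neg] at this
  linarith

/-- An odd function that is positive where `H⁺` misses the ball of radius `R`, and vanishes where
the boundary hyperplane meets that ball. -/
noncomputable def poleBump (R : ℝ) (u : EuclideanSpace ℝ (Fin (n + 1))) : ℝ :=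
  max 0 (lastPart u - R * ‖firstPart u‖) - max 0 (-lastPart u - R * ‖firstPart u‖)

lemma continuous_poleBump (R : ℝ) :
    Continuous (poleBump R : EuclideanSpace ℝ (Fin (n + 1)) → ℝ) := by
  have h1 : Continuous fun u : EuclideanSpace ℝ (Fin (n + 1)) => R * ‖firstPart u‖ :=
    continuous_const.mul continuous_firstPart.norm
  exact (continuous_const.max (continuous_lastPart.sub h1)).sub
    (continuous_const.max (continuous_lastPart.neg.sub h1))

lemma poleBump_neg (R : ℝ) (u : EuclideanSpace ℝ (Fin (n + 1))) :
    poleBump R (-u) = -poleBump R u := by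
  simp [poleBump, firstPart_neg, lastPart_neg]

/-- Otherwise `H⁺` misses `A`, its spread is `0`, and the remaining terms are one nonpositive and
one strictly negative. -/
lemma lastPart_le_of_plusSpread_sub_eq_zero (hA : IsCompact A) {R : ℝ} (hR : 0 ≤ R)
    (hAR : ∀ x ∈ A, ‖x‖ ≤ R)
    (h : plusSpread Q A u - plusSpread Q A (-u) - poleBump R u = 0) :
    lastPart u ≤ R * ‖firstPart u‖ := by
  by_contra! hlt
  have hempty : A ∩ Hplus u = ∅ := by
    refine Set.eq_empty_of_forall_notMem fun x hx => ?_
    have h1 : lastPart u ≤ inner ℝ (firstPart u) x := hx.2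
    have h2 := real_inner_le_norm (firstPart u) x
    have h3 := mul_le_mul_of_nonneg_left (hAR x hx.1) (norm_nonneg (firstPart u))
    linarith [mul_comm R ‖firstPart u‖]
  have h4 : 0 ≤ R * ‖firstPart u‖ := by positivity
  rw [plusSpread_eq_zero_of_eq_empty hA hempty, poleBump, max_eq_right (by linarith),
    max_eq_left (by linarith)] at h
  linarith [plusSpread_nonneg (Q := Q) (u := -u) hA]

end Spread

end HamSandwichOpt

theorem mainTheorem3 (n : ℕ) (A : Fin n → Set (EuclideanSpace ℝ (Fin n)))
    (hcompact : ∀ i, IsCompact (A i))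
    (hconvex : ∀ i, Convex ℝ (A i))
    (hint : ∀ i, (interior (A i)).Nonempty)
    (hsupp : ∀ i, ∀ x ∈ frontier (A i), ∀ H : Set (EuclideanSpace ℝ (Fin n)),
      HamSandwichOpt.IsSupportingHyperplaneAt H (A i) x → ∃ y, A i ∩ H = {y})
    (Q : Fin n → Matrix (Fin n) (Fin n) ℝ)
    (hQ : ∀ i, IsUnit (Q i)) :
    ∃ u ∈ Metric.sphere (0 : EuclideanSpace ℝ (Fin (n + 1))) 1, ∀ i,
      (A i ∩ HamSandwichOpt.Hplus u).Nonempty ∧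
      (A i ∩ HamSandwichOpt.Hminus u).Nonempty ∧
      ∃ d : ℝ,
        HamSandwichOpt.IsSpread (fun x => HamSandwichOpt.bilinearObjective (Q i) x u)
          (A i ∩ HamSandwichOpt.Hplus u) d ∧
        HamSandwichOpt.IsSpread (fun x => HamSandwichOpt.bilinearObjective (Q i) x u)
          (A i ∩ HamSandwichOpt.Hminus u) d := by
  open HamSandwichOpt in
  obtain ⟨R, hR, hAR⟩ := (Bornology.isBounded_iUnion.2
    fun i => (hcompact i).isBounded).exists_pos_norm_le
  replace hAR : ∀ i, ∀ x ∈ A i, ‖x‖ ≤ R := fun i x hx => hAR x (Set.mem_iUnion.2 ⟨i, hx⟩)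
  have hne : ∀ u ∈ Metric.sphere (0 : EuclideanSpace ℝ (Fin (n + 1))) 1, u ≠ 0 := by
    rintro _ hu rfl
    simp at hu
  obtain ⟨u, hu, hzero⟩ := exists_zero_of_odd_continuousOn_sphere
    (fun u i => plusSpread (Q i) (A i) u - plusSpread (Q i) (A i) (-u) - poleBump R u)
    (continuousOn_pi.2 fun i u hu => ContinuousAt.continuousWithinAt <| by
      have h1 : ∀ v ≠ 0, ContinuousAt (plusSpread (Q i) (A i)) v := fun v hv =>
        continuousAt_plusSpread hv (hcompact i) (hconvex i) (hsupp i)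
      exact ((h1 u (hne u hu)).sub ((h1 (-u) (neg_ne_zero.2 (hne u hu))).comp
        continuous_neg.continuousAt)).sub (continuous_poleBump R).continuousAt)
    (fun u _ => funext fun i => by
      simp only [poleBump_neg, neg_neg, Pi.neg_apply]
      ring)
  refine ⟨u, hu, fun i => ?_⟩
  have hz := congrFun hzero i
  simp only [Pi.zero_apply] at hz
  have hlast := lastPart_le_of_plusSpread_sub_eq_zero (hcompact i) hR.le (hAR i) hz
  -- Oddness transfers the bound to `-u`. Together the two bounds rule out the poles and make
  -- `poleBump R u` vanish.
  have hlast' := lastPart_le_of_plusSpread_sub_eq_zero (Q := Q i) (u := -u) (hcompact i) hR.le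
    (hAR i) (by rw [neg_neg, poleBump_neg]; linarith)
  rw [lastPart_neg, firstPart_neg, norm_neg] at hlast'
  have hfirst : firstPart u ≠ 0 := by
    intro h0
    rw [h0, norm_zero, mul_zero] at hlast hlast'
    exact hne u hu (eq_zero_of_firstPart_lastPart h0 (by linarith))
  rw [poleBump, max_eq_left (by linarith), max_eq_left (by linarith), sub_self, sub_zero,
    sub_eq_zero] at hz
  have hplus := nonempty_inter_Hplus_of_plusSpread_eq (hcompact i) (hint i) (hQ i) hfirst hz
  have hminus : (A i ∩ Hminus u).Nonempty := by
    rw [← Hplus_neg]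
    exact nonempty_inter_Hplus_of_plusSpread_eq (hcompact i) (hint i) (hQ i)
      (neg_ne_zero.2 hfirst) (by rw [neg_neg, hz])
  refine ⟨hplus, hminus, plusSpread (Q i) (A i) u, isSpread_plusSpread (hcompact i) hplus, ?_⟩
  rw [hz]
  exact isSpread_plusSpread_neg (hcompact i) hminus
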